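/- Let $(R,\mathfrak m)$ be a commutative Noetherian local ring, let $x\in R$, and put $\mathfrak a=(x)$, $X=\operatorname{Spec}(R)\setminus\{\mathfrak m\}$ and $Y=V(\mathfrak a)\setminus\{\mathfrak m\}\subseteq X$. For a finitely generated $R$-module $M$ let $\mathcal F=\widetilde M|_X$ be the associated sheaf on $X$. Let $\widehat X$ be the formal completion of $X$ along $Y$, that is, the space $Y$ with the sheaf of rings $\mathcal O_{\widehat X}=\varprojlim_n(\mathcal O_X/\mathfrak a^n\mathcal O_X)|_Y$, and let $\widehat{\mathcal F}=\varprojlim_n(\mathcal F/\mathfrak a^n\mathcal F)|_Y$. (1) Let $M$ be a finitely generated $R$-module such that $x$ is a nonzerodivisor on $M$, $M$ is complete (and separated) in the $x$-adic topology, and the local cohomology modules $H^1_{\mathfrak m}(M)$ and $H^2_{\mathfrak m}(M)$ are each annihilated by some power of $x$. Then the natural map $H^0(X,\mathcal F)\to H^0(\widehat X,\widehat{\mathcal F})$ is an isomorphism of $R$-modules. (2) Suppose that $R$ is $\mathfrak m$-adically complete, that $\dim R>2$, that $R$ is generalized Cohen–Macaulay (i.e. $H^i_{\mathfrak m}(R)$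 has finite length for all $i<\dim R$), and that $x\in\mathfrak m$ is a nonzerodivisor of $R$. Then $Y$ is $G_2$ in $X$, i.e. the natural ring homomorphism $H^0(X,\mathcal O_X)\to H^0(\widehat X,\mathcal O_{\widehat X})$ is an isomorphism. -/

import Mathlib

open AlgebraicGeometry CategoryTheory TopologicalSpace Opposite IsLocalRing

universe u

noncomputable section

namespace FormalGeometry

section Completion

variable (R : Type u) [CommRing R]

/-- The punctured spectrum `X = Spec R ∖ {𝔪}` of a local ring, as an open subset of `Spec R`. -/
def puncturedSpectrum [IsLocalRing R] : (Spec (CommRingCat.of R)).Opens :=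
  ⟨{closedPoint R}ᶜ, (isClosed_singleton_closedPoint R).isOpen_compl⟩

variable {R}

/-- The closed subset `Y = V(𝔞) ∖ {𝔪}` of the punctured spectrum. -/
def puncturedLocus [IsLocalRing R] (a : Ideal R) : Set (PrimeSpectrum R) :=
  PrimeSpectrum.zeroLocus a \ {closedPoint R}

/-- `Y = V(𝔞) ∖ {𝔪}` with the subspace topology. -/
def puncturedLocusTop [IsLocalRing R] (a : Ideal R) : TopCat.{u} :=
  TopCat.of (puncturedLocus a)

/-- The point of `Spec R` underlying a point of `Y`. -/
def toSpec [IsLocalRing R] {a : Ideal R} (y : puncturedLocusTop a) : PrimeSpectrum R :=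
  Subtype.val (p := fun q => q ∈ puncturedLocus a) y

/-- The module `lim_n M_p / 𝔞ⁿ M_p`, where `M_p / 𝔞ⁿ M_p` is the stalk at `p` of the
quasi-coherent sheaf `F / 𝔞ⁿ F`, `F` being the sheaf associated to `M`. -/
abbrev CompletedLocalization (a : Ideal R) (M : Type u) [AddCommGroup M] [Module R M]
    (p : PrimeSpectrum R) : Type u :=
  AdicCompletion (a.map (algebraMap R (Localization p.asIdeal.primeCompl)))
    (LocalizedModule p.asIdeal.primeCompl M)

/-- A family of elements `s z ∈ lim_n M_z / 𝔞ⁿ M_z` over an open subset of `Y` is a fraction at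
level `n` if there are `m ∈ M`, `f ∈ R` such that `f ∉ z` and `s z ≡ m / f` in `M_z / 𝔞ⁿ M_z`
for all `z`. -/
def isFractionAt [IsLocalRing R] (a : Ideal R) (M : Type u) [AddCommGroup M] [Module R M]
    (n : ℕ) :
    TopCat.PrelocalPredicate
      (fun y : puncturedLocusTop a => CompletedLocalization a M (toSpec y)) where
  pred {U} s := ∃ (m : M) (f : R), ∀ z : U, ∃ hf : f ∉ (toSpec z.1).asIdeal,
    (s z).val n = Submodule.Quotient.mk (LocalizedModule.mk m ⟨f, hf⟩)
  res := by
    rintro U V i s ⟨m, f, h⟩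
    exact ⟨m, f, fun z => h (i z)⟩

/-- The predicate that cuts out the sections of the completion `F̂ = lim_n (F / 𝔞ⁿ F)|_Y`
of the sheaf `F` associated to `M`.
For each `n`, the sections over `V ⊆ Y` of the inverse image of `F / 𝔞ⁿ F` are the families
of elements of the stalks `M_z / 𝔞ⁿ M_z`, `z ∈ V`, that locally on `V` come from a fraction `m / f`.
A section of the inverse limit is a compatible sequence of these, that is, a family of elements
of `lim_n M_z / 𝔞ⁿ M_z` which, for every `n`, is modulo `𝔞ⁿ` locally a fraction; the
neighbourhoods may depend on `n`. -/
def completionPredicate [IsLocalRing R] (a : Ideal R) (M : Type u) [AddCommGroup M]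
    [Module R M] :
    TopCat.LocalPredicate
      (fun y : puncturedLocusTop a => CompletedLocalization a M (toSpec y)) where
  pred s := ∀ n, (isFractionAt a M n).sheafify.pred s
  res i s h n := (isFractionAt a M n).sheafify.res i s (h n)
  locality s h n := (isFractionAt a M n).sheafify.locality s fun x => by
    obtain ⟨V, hx, i, hV⟩ := h x
    exact ⟨V, hx, i, hV n⟩

variable [IsLocalRing R] (a : Ideal R) (M : Type u) [AddCommGroup M] [Module R M]

/-- The sections of `F̂` over `V ⊆ Y`, as a submodule of a product. -/
def completionSections (V : Opens (puncturedLocusTop a)) :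
    Submodule R (∀ y : V, CompletedLocalization a M (toSpec y.1)) where
  carrier := {s | (completionPredicate a M).pred s}
  add_mem' {s t} hs ht n x := by
    obtain ⟨V₁, h₁, i₁, m₁, f₁, w₁⟩ := hs n x
    obtain ⟨V₂, h₂, i₂, m₂, f₂, w₂⟩ := ht n x
    refine ⟨V₁ ⊓ V₂, ⟨h₁, h₂⟩, Opens.infLELeft _ _ ≫ i₁, f₂ • m₁ + f₁ • m₂, f₁ * f₂, fun z => ?_⟩
    obtain ⟨hf₁, e₁⟩ := w₁ ⟨z.1, z.2.1⟩
    obtain ⟨hf₂, e₂⟩ := w₂ ⟨z.1, z.2.2⟩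
    refine ⟨(toSpec z.1).asIdeal.primeCompl.mul_mem hf₁ hf₂, (congrArg₂ (· + ·) e₁ e₂).trans ?_⟩
    exact congrArg Submodule.Quotient.mk (LocalizedModule.mk_add_mk (m1 := m₁) (m2 := m₂)
      (s1 := ⟨f₁, hf₁⟩) (s2 := ⟨f₂, hf₂⟩))
  zero_mem' n x := ⟨V, x.2, 𝟙 _, 0, 1, fun z =>
    ⟨(toSpec z.1).asIdeal.primeCompl.one_mem,
      (congrArg Submodule.Quotient.mk (LocalizedModule.zero_mk _)).symm⟩⟩
  smul_mem' r s hs n x := by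
    obtain ⟨W, h, i, m, f, w⟩ := hs n x
    refine ⟨W, h, i, r • m, f, fun z => ?_⟩
    obtain ⟨hf, e⟩ := w z
    refine ⟨hf, (congrArg (r • ·) e).trans ?_⟩
    exact congrArg Submodule.Quotient.mk (LocalizedModule.smul'_mk (S := (toSpec z.1).asIdeal.primeCompl)
      r m ⟨f, hf⟩)

/-- The sections of `O_X̂` over `V ⊆ Y`, as a subring of a product. -/
def completionSubring (V : Opens (puncturedLocusTop a)) :
    Subring (∀ y : V, CompletedLocalization a R (toSpec y.1)) where
  __ := (completionSections a R V).toAddSubgroup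
  one_mem' n x := ⟨V, x.2, 𝟙 _, 1, 1, fun z =>
    ⟨(toSpec z.1).asIdeal.primeCompl.one_mem,
      congrArg (Ideal.Quotient.mk _) (OreLocalization.one_def)⟩⟩
  mul_mem' {s t} hs ht n x := by
    obtain ⟨V₁, h₁, i₁, m₁, f₁, w₁⟩ := hs n x
    obtain ⟨V₂, h₂, i₂, m₂, f₂, w₂⟩ := ht n x
    refine ⟨V₁ ⊓ V₂, ⟨h₁, h₂⟩, Opens.infLELeft _ _ ≫ i₁, m₁ * m₂, f₁ * f₂, fun z => ?_⟩
    obtain ⟨hf₁, e₁⟩ := w₁ ⟨z.1, z.2.1⟩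
    obtain ⟨hf₂, e₂⟩ := w₂ ⟨z.1, z.2.2⟩
    refine ⟨(toSpec z.1).asIdeal.primeCompl.mul_mem hf₁ hf₂, (congrArg₂ (· * ·) e₁ e₂).trans ?_⟩
    exact congrArg (Ideal.Quotient.mk _) (LocalizedModule.mk_mul_mk (a₁ := m₁) (a₂ := m₂)
      (s₁ := ⟨f₁, hf₁⟩) (s₂ := ⟨f₂, hf₂⟩))

/-- The completion `F̂` of the sheaf associated to `M` along `Y`, a sheaf of `R`-modules on `Y`. -/
def completionSheaf : TopCat.Sheaf (ModuleCat.{u} R) (puncturedLocusTop a) where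
  obj :=
    { obj := fun V => ModuleCat.of R (completionSections a M V.unop)
      map := fun {V W} i => ModuleCat.ofHom
        { toFun := fun s => ⟨fun y => s.1 (i.unop y), (completionPredicate a M).res i.unop s.1 s.2⟩
          map_add' := fun _ _ => rfl
          map_smul' := fun _ _ => rfl } }
  property := (TopCat.Presheaf.isSheaf_iff_isSheaf_comp (forget (ModuleCat R)) _).2
    (TopCat.subsheafToTypes (completionPredicate a M)).2

/-- The formal completion `X̂` of the punctured spectrum `X` along `Y`, a ringed space:
the topological space `Y` with the sheaf of rings `O_X̂ = lim_n (O_X / 𝔞ⁿ O_X)|_Y`. -/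
def formalCompletion : RingedSpace.{u, u} where
  carrier := puncturedLocusTop a
  presheaf :=
    { obj := fun V => CommRingCat.of (completionSubring a V.unop)
      map := fun {V W} i => CommRingCat.ofHom
        { toFun := fun s =>
            ⟨fun y => s.1 (i.unop y), (completionPredicate a R).res i.unop s.1 (id s.2)⟩
          map_one' := rfl
          map_mul' := fun _ _ => rfl
          map_zero' := rfl
          map_add' := fun _ _ => rfl } }
  IsSheaf := (TopCat.Presheaf.isSheaf_iff_isSheaf_comp (forget CommRingCat) _).2
    (TopCat.subsheafToTypes (completionPredicate a R)).2

/-- `H⁰(X, F)` as an `R`-module, where `F` is the restriction to the punctured spectrum `X` of the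
sheaf associated to `M`. -/
abbrev H0 : ModuleCat.{u} R :=
  (modulesSpecToSheaf.obj (tilde (R := CommRingCat.of R) (ModuleCat.of R M))).presheaf.obj
    (op (puncturedSpectrum R))

/-- The natural `R`-linear map `H⁰(X, F) → H⁰(X̂, F̂)`, where `F` is the restriction to `X` of the
sheaf associated to `M`: it sends a section to the family of its germs along `Y`. -/
def toCompletion :
    H0 (R := R) M →ₗ[R] (completionSheaf a M).presheaf.obj (op ⊤) where
  toFun s :=
    ⟨fun y => AdicCompletion.of _ _
      (Subtype.val (p := (StructureSheaf.isLocallyFraction R M).pred) s ⟨toSpec y.1, y.1.2.2⟩), by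
      intro n x
      obtain ⟨V, hx, i, m, f, w⟩ := Subtype.property
        (p := (StructureSheaf.isLocallyFraction R M).pred) s ⟨toSpec x.1, x.1.2.2⟩
      refine ⟨⟨{y | toSpec y ∈ V.1}, V.2.preimage continuous_subtype_val⟩, hx, homOfLE le_top, m, f,
        fun z => ?_⟩
      obtain ⟨hf, e⟩ := w ⟨toSpec z.1, z.2⟩
      exact ⟨hf, congrArg Submodule.Quotient.mk e⟩⟩
  map_add' s t := by
    refine Subtype.ext (funext fun y => ?_)
    exact map_add (AdicCompletion.of _ _) _ _
  map_smul' r s := by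
    refine Subtype.ext (funext fun y => ?_)
    refine (congrArg (AdicCompletion.of _ _) (congrFun (congrArg Subtype.val
      (IsScalarTower.algebraMap_smul (M := (structureSheafInType R M).obj.obj
        (op (puncturedSpectrum R))) ((structureSheafInType R R).obj.obj
          (op (puncturedSpectrum R))) r s)) ⟨toSpec y.1, y.1.2.2⟩)).trans ?_
    rfl

/-- The natural ring homomorphism `H⁰(X, O_X) → H⁰(X̂, O_X̂)`. -/
def toCompletionRing :
    Γ(Spec (CommRingCat.of R), puncturedSpectrum R) →+*
      (formalCompletion a).presheaf.obj (op ⊤) where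
  toFun s :=
    ⟨fun y => AdicCompletion.of _ _
      (Subtype.val (p := (StructureSheaf.isLocallyFraction R R).pred) s ⟨toSpec y.1, y.1.2.2⟩),
      (toCompletion a R s).2⟩
  map_one' := rfl
  map_mul' s t := rfl
  map_zero' := rfl
  map_add' s t := by
    refine Subtype.ext (funext fun y => ?_)
    exact map_add (AdicCompletion.of _ _) _ _

/-- `Y` is `G₂` in `X` if the natural map `H⁰(X, O_X) → H⁰(X̂, O_X̂)` is an isomorphism. -/
def IsG2 : Prop :=
  Function.Bijective (toCompletionRing a)

end Completion

/-- A local ring `(R, 𝔪)` is generalized Cohen-Macaulay if the local cohomology modules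
`Hⁱ_𝔪(R)`, `i < dim R`, have finite length. -/
def IsGeneralizedCohenMacaulay (R : Type u) [CommRing R] [IsLocalRing R] : Prop :=
  ∀ i : ℕ, (i : WithBot ℕ∞) < ringKrullDim R →
    IsFiniteLength R ((localCohomology (maximalIdeal R) i).obj (ModuleCat.of R R))

end FormalGeometry

end

/-!
Write `Γ(F)` for the sections over `X` of the sheaf associated to `M`. By Deligne's formula `Γ(F)`
is the direct limit of the modules `Hom(𝔪ᵃ, M)`, and likewise for `M ⧸ xⁿM`.

A section of `F̂` at level `n + k` is a section of the sheaf of `M ⧸ xⁿ⁺ᵏM`, that is, a linear map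
`𝔪ᵃ → M ⧸ xⁿ⁺ᵏM`. On passing to level `n` the obstruction to lifting it to `M`, a class in
`Ext¹(𝔪ᵃ, M)`, is multiplied by `xᵏ`, and for large `k` this kills it in the limit `H²_𝔪(M)`.
Hence every section of `F̂` agrees with an element of `Γ(F)` at each level.

Similarly, if `xᵏ` kills `H¹_𝔪(M)`, then `xᵏΓ(F) ⊆ M ⊆ Γ(F)`, so `Γ(F)` inherits `x`-adic
completeness from `M`. Since `x` is regular, congruence modulo `xⁿΓ(F)` can be tested on the germs
along `Y`, and the approximations glue to a unique element of `Γ(F)`.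

In a generalized Cohen-Macaulay ring `H¹_𝔪(R)` and `H²_𝔪(R)` have finite length, so a power of
`x ∈ 𝔪` kills them.
-/

universe v w t

namespace FormalGeometry

section ExtComparison

open Limits HomologicalComplex

lemma homologyUnop_inv_naturality {ι V : Type*} [Category V] [HasZeroMorphisms V]
    {c : ComplexShape ι} {K L : HomologicalComplex Vᵒᵖ c} (ψ : K ⟶ L) (i : ι)
    [K.HasHomology i] [L.HasHomology i] :
    (homologyMap ψ i).unop ≫ (K.homologyUnop i).inv =
      (L.homologyUnop i).inv ≫ homologyMap ((unopFunctor V c).map ψ.op) i := by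
  refine (Iso.eq_inv_comp _).2 ((Category.assoc _ _ _).symm.trans ((Iso.comp_inv_eq _).2 ?_))
  exact congrArg Quiver.Hom.unop (homologyOp_hom_naturality ((unopFunctor V c).map ψ.op) i)

lemma exists_iCycles_eq {A : Type*} [Ring A] {ι : Type*} {c : ComplexShape ι}
    (K : HomologicalComplex (ModuleCat.{w} A) c) {i j : ι} (hij : c.next i = j) (f : K.X i)
    (hf : K.d i j f = 0) : ∃ z : K.cycles i, K.iCycles i z = f := by
  subst hij
  exact (ShortComplex.moduleCat_exact_iff (ShortComplex.mk (K.iCycles i) (K.d i (c.next i))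
    (by simp))).1 (ShortComplex.exact_of_f_is_kernel _ (K.cyclesIsKernel i _ rfl)) f hf

lemma exists_d_eq_of_homologyπ_eq_zero {A : Type*} [Ring A] {ι : Type*} {c : ComplexShape ι}
    (K : HomologicalComplex (ModuleCat.{w} A) c) {i j : ι} (hij : c.prev j = i) (z : K.cycles j)
    (hz : K.homologyπ j z = 0) : ∃ g : K.X i, K.d i j g = K.iCycles j z := by
  obtain ⟨g, hg⟩ := (ShortComplex.moduleCat_exact_iff (ShortComplex.mk (K.toCycles i j)
    (K.homologyπ j) (by simp))).1
      (ShortComplex.exact_of_g_is_cokernel _ (K.homologyIsCokernel i j hij)) z hz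
  refine ⟨g, ?_⟩
  rw [← K.toCycles_i i j]
  exact congrArg (K.iCycles j) hg

variable {R : Type t} [Ring R] {C : Type u} [Category.{v} C] [Abelian C] [Linear R C]
  [EnoughProjectives C]

variable (R) in
/-- The map of complexes `Hom(P, Y) ⟶ Hom(P', Y)` given by precomposition with a chain map
`P' ⟶ P`. -/
noncomputable abbrev linearYonedaObjMap {P P' : ChainComplex C ℕ} (φ : P' ⟶ P) (Y : C) :
    P.linearYonedaObj R Y ⟶ P'.linearYonedaObj R Y :=
  (unopFunctor _ _).map ((((linearYoneda R C).obj Y).rightOp.mapHomologicalComplex _).map φ).op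

variable {X X' : C} {P : ProjectiveResolution X} {P' : ProjectiveResolution X'} {g : X' ⟶ X}

lemma isoExt_hom_naturality (φ : P'.Hom P g) (n : ℕ) (Y : C) :
    ((Ext R C n).map g.op).app Y ≫ (P'.isoExt n Y).hom =
      (P.isoExt n Y).hom ≫ homologyMap (linearYonedaObjMap R φ.hom Y) n := by
  have comm : φ.hom.f 0 ≫ P.π.f 0 = P'.π.f 0 ≫ g := by
    simpa using φ.hom_f_zero_comp_π_f_zero
  have leftDerived := congrArg Quiver.Hom.unop
    (ProjectiveResolution.isoLeftDerivedObj_inv_naturality g P' P φ.hom comm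
      ((linearYoneda R C).obj Y).rightOp n)
  have unop := homologyUnop_inv_naturality
    ((((linearYoneda R C).obj Y).rightOp.mapHomologicalComplex _).map φ.hom) n
  refine (Category.assoc _ _ _).symm.trans
    ((congrArg (· ≫ (homologyUnop _ _).inv) leftDerived).trans ((Category.assoc _ _ _).trans ?_))
  exact (congrArg ((P.isoLeftDerivedObj ((linearYoneda R C).obj Y).rightOp n).inv.unop ≫ ·)
    unop).trans (Category.assoc _ _ _).symm

variable (R P) in
/-- The class in `Extⁿ(X, Y)` of an `n`-cocycle of `Hom(P, Y)`, where `P` is a projective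
resolution of `X`. -/
noncomputable abbrev cocycleClass (n : ℕ) (Y : C) (z : (P.complex.linearYonedaObj R Y).cycles n) :
    ((Ext R C n).obj (op X)).obj Y :=
  (P.isoExt n Y).inv ((P.complex.linearYonedaObj R Y).homologyπ n z)

lemma map_cocycleClass (φ : P'.Hom P g) (n : ℕ) (Y : C)
    (z : (P.complex.linearYonedaObj R Y).cycles n) :
    ((Ext R C n).map g.op).app Y (cocycleClass R P n Y z) =
      cocycleClass R P' n Y (cyclesMap (linearYonedaObjMap R φ.hom Y) n z) := by
  have natural := (Iso.eq_comp_inv _).2 (isoExt_hom_naturality (R := R) φ n Y)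
  have natural' : (P.isoExt n Y).inv ≫ ((Ext R C n).map g.op).app Y =
      homologyMap (linearYonedaObjMap R φ.hom Y) n ≫ (P'.isoExt n Y).inv := by
    rw [Iso.inv_comp_eq, natural, Category.assoc]
  refine (ConcreteCategory.congr_hom natural' _).trans ?_
  exact congrArg (P'.isoExt n Y).inv
    (ConcreteCategory.congr_hom (homologyπ_naturality (linearYonedaObjMap R φ.hom Y) n) z)

lemma exists_d_comp_eq_of_cocycleClass_eq_zero (n : ℕ) (Y : C)
    (z : (P.complex.linearYonedaObj R Y).cycles (n + 1))
    (hz : cocycleClass R P (n + 1) Y z = 0) :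
    ∃ h : P.complex.X n ⟶ Y,
      P.complex.d (n + 1) n ≫ h = (P.complex.linearYonedaObj R Y).iCycles (n + 1) z := by
  refine exists_d_eq_of_homologyπ_eq_zero _ (by simp) z ?_
  have := congrArg (P.isoExt (n + 1) Y).hom hz
  rwa [map_zero, Iso.inv_hom_id_apply] at this

lemma exists_coboundary_of_map_smul_cocycleClass_eq_zero (φ : P'.Hom P g) (n : ℕ) {Y : C}
    {z : (P.complex.linearYonedaObj R Y).cycles (n + 1)} {f : P.complex.X (n + 1) ⟶ Y}
    (hf : (P.complex.linearYonedaObj R Y).iCycles (n + 1) z = f) (r : R)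
    (hz : ((Ext R C (n + 1)).map g.op).app Y (r • cocycleClass R P (n + 1) Y z) = 0) :
    ∃ h : P'.complex.X n ⟶ Y,
      P'.complex.d (n + 1) n ≫ h = φ.hom.f (n + 1) ≫ (r • f) := by
  have class_smul : r • cocycleClass R P (n + 1) Y z = cocycleClass R P (n + 1) Y (r • z) := by
    simp only [cocycleClass, map_smul]
  rw [class_smul, map_cocycleClass φ] at hz
  obtain ⟨h, hh⟩ := exists_d_comp_eq_of_cocycleClass_eq_zero n Y _ hz
  refine ⟨h, hh.trans ?_⟩
  refine (ConcreteCategory.congr_hom (cyclesMap_i (linearYonedaObjMap R φ.hom Y) (n + 1))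
    (r • z)).trans ?_
  refine congrArg ((linearYonedaObjMap R φ.hom Y).f (n + 1)) ((map_smul _ r z).trans ?_)
  exact congrArg (r • ·) hf

end ExtComparison

section LocalCohomology

open Limits

variable {R : Type u} [CommRing R]

/-- The projection `R ⧸ J ⟶ R ⧸ I` for `J ≤ I`. -/
noncomputable abbrev quotientProj {I J : Ideal R} (h : J ≤ I) :
    ModuleCat.of R (R ⧸ J) ⟶ ModuleCat.of R (R ⧸ I) :=
  ModuleCat.ofHom (Submodule.mapQ J I LinearMap.id h)

lemma exists_map_quotientProj_smul_eq_zero (J : Ideal R) (i : ℕ) (M : ModuleCat.{u} R) (r : R)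
    (h : ∀ z : (localCohomology J i).obj M, r • z = 0) (a : ℕ)
    (ξ : ((Ext R (ModuleCat.{u} R) i).obj (op (ModuleCat.of R (R ⧸ J ^ a)))).obj M) :
    ∃ (b : ℕ) (hb : J ^ b ≤ J ^ a),
      ((Ext R (ModuleCat.{u} R) i).map (quotientProj hb).op).app M (r • ξ) = 0 := by
  let D := localCohomology.diagram (localCohomology.idealPowersDiagram J) i
  have : HasColimit D := localCohomology.hasColimitDiagram.{u, 0} _ _
  let F := (evaluation (ModuleCat.{u} R) (ModuleCat.{u} R)).obj M
  let ι := (F.mapCocone (colimit.cocone D)).ι.app (op (op a))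
  have hc : IsColimit (F.mapCocone (colimit.cocone D)) :=
    isColimitOfPreserves F (colimit.isColimit D)
  have h0 : ι (r • ξ) = ι (0 : (D ⋙ F).obj (op (op a))) := by
    rw [map_zero]
    exact (map_smul ι.hom r ξ).trans (h _)
  have := preservesSmallestFilteredColimits_of_preservesFilteredColimits (forget (ModuleCat.{u} R))
  have : PreservesColimit (D ⋙ F) (forget (ModuleCat.{u} R)) := inferInstance
  obtain ⟨k, f, g, hk⟩ := Concrete.isColimit_exists_of_rep_eq (D ⋙ F) hc _ _ h0
  refine ⟨k.unop.unop, Ideal.pow_le_pow_right f.unop.unop.down.down, ?_⟩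
  rw [map_zero] at hk
  exact hk

lemma exists_quotientProj_comp_smul_eq_zero (J : Ideal R) (i : ℕ) (M : ModuleCat.{u} R) (r : R)
    (h : ∀ z : (localCohomology J (i + 1)).obj M, r • z = 0) (a : ℕ)
    (α : Abelian.Ext (ModuleCat.of R (R ⧸ J ^ a)) M (i + 1)) :
    ∃ (b : ℕ) (hb : J ^ b ≤ J ^ a),
      (Abelian.Ext.mk₀ (quotientProj hb)).comp (r • α) (zero_add _) = 0 := by
  let P := projectiveResolution (ModuleCat.of R (R ⧸ J ^ a))
  obtain ⟨f, hf, rfl⟩ := P.extMk_surjective α (i + 2) rfl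
  obtain ⟨z, hz⟩ := exists_iCycles_eq (P.complex.linearYonedaObj R M)
    (by simp : _ = i + 2) f hf
  obtain ⟨b, hb, h0⟩ := exists_map_quotientProj_smul_eq_zero J (i + 1) M r h a
    (cocycleClass R P (i + 1) M z)
  let P' := projectiveResolution (ModuleCat.of R (R ⧸ J ^ b))
  let φ : P'.Hom P (quotientProj hb) := ⟨ProjectiveResolution.lift (quotientProj hb) P' P, by
    simpa using ProjectiveResolution.lift_commutes_zero (quotientProj hb) P' P⟩
  obtain ⟨y, hy⟩ := exists_coboundary_of_map_smul_cocycleClass_eq_zero φ i hz r h0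
  refine ⟨b, hb, ?_⟩
  rw [Abelian.Ext.smul_eq_comp_mk₀, P.extMk_comp_mk₀, ProjectiveResolution.mk₀_comp_extMk _ _ _ _ φ,
    P'.extMk_eq_zero_iff _ _ _ _ i rfl]
  exact ⟨y, by simpa using hy⟩

/-- The short complex `I ⟶ R ⟶ R ⧸ I`. -/
noncomputable abbrev idealShortComplex (I : Ideal R) : ShortComplex (ModuleCat.{u} R) :=
  ShortComplex.mk (ModuleCat.ofHom (Submodule.subtype I)) (ModuleCat.ofHom (Submodule.mkQ I))
    (by ext x; exact Ideal.Quotient.eq_zero_iff_mem.2 x.2)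

lemma shortExact_idealShortComplex (I : Ideal R) : (idealShortComplex I).ShortExact where
  exact := by
    rw [ShortComplex.moduleCat_exact_iff]
    intro x hx
    exact ⟨⟨x, (Submodule.Quotient.mk_eq_zero _).1 hx⟩, rfl⟩
  mono_f := (ModuleCat.mono_iff_injective _).2 I.injective_subtype
  epi_g := (ModuleCat.epi_iff_surjective _).2 (Submodule.mkQ_surjective I)

/-- The inclusion `J ⟶ I` for `J ≤ I`. -/
noncomputable abbrev idealInclusion {I J : Ideal R} (h : J ≤ I) :
    ModuleCat.of R J ⟶ ModuleCat.of R I :=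
  ModuleCat.ofHom (Submodule.inclusion h)

lemma idealShortComplex_extClass_naturality {I J : Ideal R} (h : J ≤ I) :
    (shortExact_idealShortComplex J).extClass.comp (Abelian.Ext.mk₀ (idealInclusion h))
      (add_zero 1) =
    (Abelian.Ext.mk₀ (quotientProj h)).comp (shortExact_idealShortComplex I).extClass
      (zero_add 1) :=
  ShortComplex.ShortExact.extClass_naturality (shortExact_idealShortComplex J)
    (shortExact_idealShortComplex I)
    { τ₁ := idealInclusion h, τ₂ := 𝟙 _, τ₃ := quotientProj h }

lemma exists_extension_smul_comp_idealInclusion (J : Ideal R) (i : ℕ) (M : ModuleCat.{u} R)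
    (r : R) (h : ∀ z : (localCohomology J (i + 1)).obj M, r • z = 0) (a : ℕ)
    (β : Abelian.Ext (ModuleCat.of R ↥(J ^ a)) M i) :
    ∃ (b : ℕ) (hb : J ^ b ≤ J ^ a) (γ : Abelian.Ext (ModuleCat.of R R) M i),
      (Abelian.Ext.mk₀ (idealShortComplex (J ^ b)).f).comp γ (zero_add i) =
        (Abelian.Ext.mk₀ (idealInclusion hb)).comp (r • β) (zero_add i) := by
  obtain ⟨b, hb, h0⟩ := exists_quotientProj_comp_smul_eq_zero J i M r h a
    ((shortExact_idealShortComplex (J ^ a)).extClass.comp β (add_comm 1 i))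
  refine ⟨b, hb, Abelian.Ext.contravariant_sequence_exact₁
    (shortExact_idealShortComplex (J ^ b)) M _ (add_comm 1 i) ?_⟩
  rw [← Abelian.Ext.comp_smul, ← Abelian.Ext.comp_assoc (a₁₂ := 1) _ _ _ (by lia) (by lia)
    (by lia)] at h0
  rw [← Abelian.Ext.comp_assoc (a₁₂ := 1) _ _ _ (by lia) (by lia) (by lia),
    idealShortComplex_extClass_naturality, h0]

variable {M : Type u} [AddCommGroup M] [Module R M]

lemma exists_smul_linearMap_eq_smul (J : Ideal R) (r : R)
    (h : ∀ z : (localCohomology J 1).obj (ModuleCat.of R M), r • z = 0) (a : ℕ)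
    (φ : ↥(J ^ a) →ₗ[R] M) :
    ∃ (b : ℕ) (hb : J ^ b ≤ J ^ a) (m : M), ∀ t (ht : t ∈ J ^ b), r • φ ⟨t, hb ht⟩ = t • m := by
  obtain ⟨b, hb, γ, hγ⟩ := exists_extension_smul_comp_idealInclusion J 0 (ModuleCat.of R M) r h a
    (Abelian.Ext.mk₀ (ModuleCat.ofHom φ))
  obtain ⟨g, rfl⟩ := Abelian.Ext.addEquiv₀.symm.surjective γ
  refine ⟨b, hb, g (1 : R), fun t ht => ?_⟩
  rw [← Abelian.Ext.mk₀_smul, Abelian.Ext.mk₀_comp_mk₀] at hγ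
  erw [Abelian.Ext.mk₀_comp_mk₀] at hγ
  have extends_restriction : g t = r • φ ⟨t, hb ht⟩ := ConcreteCategory.congr_hom
    (Abelian.Ext.addEquiv₀.symm.injective hγ) (⟨t, ht⟩ : ↥(J ^ b))
  rw [← extends_restriction, ← g.hom.map_smul, smul_eq_mul, mul_one]

/-- The short complex `M ⟶ M ⟶ M ⧸ xⁿM`, the first map being multiplication by `xⁿ`. -/
noncomputable abbrev powSMulShortComplex (M : Type u) [AddCommGroup M] [Module R M] (x : R)
    (n : ℕ) : ShortComplex (ModuleCat.{u} R) :=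
  ShortComplex.mk (ModuleCat.ofHom (LinearMap.lsmul R M (x ^ n)))
    (ModuleCat.ofHom (Submodule.mkQ (Ideal.span {x} ^ n • ⊤ : Submodule R M))) (by
      ext m
      exact (Submodule.Quotient.mk_eq_zero _).2 (Submodule.smul_mem_smul
        (Ideal.pow_mem_pow (Ideal.mem_span_singleton_self x) n) trivial))

lemma mem_span_singleton_pow_smul_top {A N : Type*} [CommRing A] [AddCommGroup N] [Module A N]
    {x : A} {n : ℕ} {m : N} :
    m ∈ (Ideal.span {x} ^ n • ⊤ : Submodule A N) ↔ ∃ m', x ^ n • m' = m := by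
  rw [Ideal.span_singleton_pow, Submodule.ideal_span_singleton_smul]
  simp [Submodule.mem_smul_pointwise_iff_exists]

lemma shortExact_powSMulShortComplex {x : R} (hx : IsSMulRegular M x) (n : ℕ) :
    (powSMulShortComplex M x n).ShortExact where
  exact := by
    rw [ShortComplex.moduleCat_exact_iff]
    intro m hm
    exact mem_span_singleton_pow_smul_top.1 ((Submodule.Quotient.mk_eq_zero _).1 hm)
  mono_f := (ModuleCat.mono_iff_injective _).2 (hx.pow n)
  epi_g := (ModuleCat.epi_iff_surjective _).2 (Submodule.mkQ_surjective _)

/-- The projection `M ⧸ Iⁿ⁺ᵏM → M ⧸ IⁿM`. -/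
abbrev powSMulProj (M : Type*) [AddCommGroup M] [Module R M] (I : Ideal R) (n k : ℕ) :
    (M ⧸ (I ^ (n + k) • ⊤ : Submodule R M)) →ₗ[R] M ⧸ (I ^ n • ⊤ : Submodule R M) :=
  Submodule.factor (Submodule.smul_mono_left (Ideal.pow_le_pow_right (Nat.le_add_right n k)))

lemma powSMulShortComplex_extClass_naturality {x : R} (hx : IsSMulRegular M x) (n k : ℕ) :
    x ^ k • (shortExact_powSMulShortComplex hx (n + k)).extClass =
    (Abelian.Ext.mk₀ (ModuleCat.ofHom (powSMulProj M (Ideal.span {x}) n k))).comp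
      (shortExact_powSMulShortComplex hx n).extClass (zero_add 1) := by
  rw [Abelian.Ext.smul_eq_comp_mk₀]
  exact ShortComplex.ShortExact.extClass_naturality (shortExact_powSMulShortComplex hx (n + k))
    (shortExact_powSMulShortComplex hx n)
    { τ₁ := x ^ k • 𝟙 _, τ₂ := 𝟙 _, τ₃ := ModuleCat.ofHom (powSMulProj M (Ideal.span {x}) n k)
      comm₁₂ := by ext m; simpa [pow_add, mul_smul] using smul_comm _ _ _ }

lemma exists_lift_powSMulProj_comp (J : Ideal R) {x : R} (hx : IsSMulRegular M x) (k : ℕ)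
    (h : ∀ z : (localCohomology J 2).obj (ModuleCat.of R M), x ^ k • z = 0) (n a : ℕ)
    (φ : ↥(J ^ a) →ₗ[R] M ⧸ (Ideal.span {x} ^ (n + k) • ⊤ : Submodule R M)) :
    ∃ (b : ℕ) (hb : J ^ b ≤ J ^ a) (ψ : ↥(J ^ b) →ₗ[R] M), ∀ t (ht : t ∈ J ^ b),
      Submodule.mkQ _ (ψ ⟨t, ht⟩) = powSMulProj M (Ideal.span {x}) n k (φ ⟨t, hb ht⟩) := by
  obtain ⟨b, hb, γ, hγ⟩ := exists_extension_smul_comp_idealInclusion J 1 (ModuleCat.of R M) (x ^ k)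
    h a ((Abelian.Ext.mk₀ (ModuleCat.ofHom φ)).comp
      (shortExact_powSMulShortComplex hx (n + k)).extClass (zero_add 1))
  rw [Abelian.Ext.eq_zero_of_projective γ, Abelian.Ext.comp_zero, ← Abelian.Ext.comp_smul,
    powSMulShortComplex_extClass_naturality hx, Abelian.Ext.mk₀_comp_mk₀_assoc,
    Abelian.Ext.mk₀_comp_mk₀_assoc] at hγ
  obtain ⟨ψ, hψ⟩ := Abelian.Ext.covariant_sequence_exact₃ _
    (shortExact_powSMulShortComplex hx n) _ _ hγ.symm
  obtain ⟨ψ, rfl⟩ := Abelian.Ext.addEquiv₀.symm.surjective ψ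
  erw [Abelian.Ext.mk₀_comp_mk₀] at hψ
  refine ⟨b, hb, ψ.hom, fun t ht => ?_⟩
  exact ConcreteCategory.congr_hom (Abelian.Ext.addEquiv₀.symm.injective hψ) (⟨t, ht⟩ : ↥(J ^ b))

end LocalCohomology

section LocalizedModule

variable {R M : Type*} [CommRing R] [AddCommGroup M] [Module R M] {S : Submonoid R}

lemma localizedModule_smul_bijective {r : R} (hr : r ∈ S) :
    Function.Bijective (fun μ : LocalizedModule S M => r • μ) :=
  (Module.End.isUnit_iff _).1
    (IsLocalizedModule.map_units (LocalizedModule.mkLinearMap S M) ⟨r, hr⟩)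

lemma isSMulRegular_localizedModule {x : R} (hx : IsSMulRegular M x) :
    IsSMulRegular (LocalizedModule S M) x := by
  have := hx.of_isLocalizedModule (Localization S) S (LocalizedModule.mkLinearMap S M)
  intro μ μ' h
  exact this (by simpa only [algebraMap_smul] using h)

lemma subsingleton_localizedModule {r : R} (hr : r ∈ S) (hM : ∀ m : M, r • m = 0) :
    Subsingleton (LocalizedModule S M) :=
  LocalizedModule.subsingleton_iff.2 fun m => ⟨r, hr, hM m⟩

end LocalizedModule

section ArtinRees

variable {R M N : Type*} [CommRing R] [IsNoetherianRing R] [AddCommGroup M] [Module R M]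
  [AddCommGroup N] [Module R N]

lemma exists_pow_smul_eq_bot (J : Ideal R) {K : Submodule R M} (hK : K.FG)
    (h : ∀ f ∈ J, ∀ m ∈ K, ∃ e : ℕ, f ^ e • m = 0) : ∃ e : ℕ, J ^ e • K = ⊥ := by
  have exists_pow_smul_eq_zero : ∀ m ∈ K, ∃ e : ℕ, ∀ r ∈ J ^ e, r • m = 0 := by
    intro m hm
    obtain ⟨e, he⟩ := Ideal.exists_pow_le_of_le_radical_of_fg
      (J := LinearMap.ker (LinearMap.toSpanSingleton R M m)) (I := J)
      (fun f hf => h f hf m hm) (IsNoetherian.noetherian _)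
    exact ⟨e, fun r hr => he hr⟩
  obtain ⟨S, rfl⟩ := hK
  choose! e he using exists_pow_smul_eq_zero
  refine ⟨S.sup e, le_bot_iff.1 (Submodule.smul_le.2 fun r hr m hm => (Submodule.mem_bot R).2 ?_)⟩
  induction hm using Submodule.span_induction with
  | mem m hm =>
    exact he m (Submodule.subset_span hm) r (Ideal.pow_le_pow_right (Finset.le_sup hm) hr)
  | zero => exact smul_zero r
  | add m m' _ _ h h' => rw [smul_add, h, h', add_zero]
  | smul c m _ h => rw [smul_comm, h, smul_zero]

lemma exists_pow_smul_top_inf_ker_eq_bot [Module.Finite R M] (J : Ideal R) (π : M →ₗ[R] N)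
    (h : ∀ f ∈ J, ∀ m ∈ LinearMap.ker π, ∃ e : ℕ, f ^ e • m = 0) :
    ∃ e : ℕ, J ^ e • ⊤ ⊓ LinearMap.ker π = ⊥ := by
  obtain ⟨e, he⟩ := exists_pow_smul_eq_bot J (IsNoetherian.noetherian (LinearMap.ker π)) h
  obtain ⟨c, hc⟩ := J.exists_pow_inf_eq_pow_smul (LinearMap.ker π)
  refine ⟨e + c, le_bot_iff.1 ?_⟩
  rw [hc (e + c) (Nat.le_add_left _ _), Nat.add_sub_cancel, ← he]
  exact Submodule.smul_mono le_rfl inf_le_right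

lemma exists_linearMap_comp_eq [Module.Finite R M] (J : Ideal R) (π : M →ₗ[R] R)
    (h : ∀ f ∈ J, ∀ m ∈ LinearMap.ker π, ∃ e : ℕ, f ^ e • m = 0)
    (hJ : J ≤ Ideal.radical (LinearMap.range π)) :
    ∃ (a : ℕ) (φ : ↥(J ^ a) →ₗ[R] M), ∀ r, π (φ r) = r := by
  obtain ⟨e, he⟩ := exists_pow_smul_top_inf_ker_eq_bot J π h
  obtain ⟨a, ha⟩ := Ideal.exists_pow_le_of_le_radical_of_fg hJ (IsNoetherian.noetherian _)
  let T : Submodule R M := J ^ e • ⊤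
  have injective : Function.Injective (π.comp T.subtype) :=
    (injective_iff_map_eq_zero _).2 fun m hm => Subtype.ext ((Submodule.mem_bot R).1
      (he.le ⟨m.2, hm⟩))
  have range_le : J ^ (e + a) ≤ LinearMap.range (π.comp T.subtype) := by
    rw [LinearMap.range_comp, Submodule.range_subtype, Submodule.map_smul'', Submodule.map_top,
      pow_add]
    exact Submodule.smul_mono le_rfl ha
  exact ⟨e + a, T.subtype.comp (LinearMap.codRestrictOfInjective (Submodule.subtype _) _ injective
    fun r => range_le r.2), LinearMap.codRestrictOfInjective_comp_apply _ _ injective _⟩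

end ArtinRees

section Sections

open StructureSheaf

variable {R : Type u} [CommRing R] {M N : Type u} [AddCommGroup M] [Module R M]
  [AddCommGroup N] [Module R N] {U : Opens (PrimeSpectrum R)}

/-- The sections over `U` of the sheaf associated to the module `M`. -/
abbrev ModuleSections (M : Type u) [AddCommGroup M] [Module R M]
    (U : Opens (PrimeSpectrum R)) : Type u :=
  (structureSheafInType R M).1.obj (op (U : Opens (PrimeSpectrum.Top R)))

namespace ModuleSections

lemma ext {s t : ModuleSections M U} (h : ∀ p : U, s.1 p = t.1 p) : s = t :=
  Subtype.ext (funext h)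

lemma exists_fraction (s : ModuleSections M U) (p : U) :
    ∃ (g : R) (m : M), g ∉ p.1.asIdeal ∧ PrimeSpectrum.basicOpen g ≤ U ∧
      ∀ (q : U) (hq : g ∉ q.1.asIdeal), s.1 q = LocalizedModule.mk m ⟨g, hq⟩ := by
  obtain ⟨g, hpg, hgU, m, hm⟩ := exists_const U s p.1 p.2
  exact ⟨g, m, hpg, hgU, fun q hq => (congrFun (congrArg Subtype.val hm) ⟨q.1, hq⟩).symm⟩

/-- The map on sections induced by a linear map of modules. -/
noncomputable def map (g : M →ₗ[R] N) : ModuleSections M U →ₗ[R] ModuleSections N U where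
  toFun s := ⟨fun p : U => LocalizedModule.map p.1.asIdeal.primeCompl g (s.1 p), fun p => by
    obtain ⟨f, m, hpf, -, hm⟩ := exists_fraction s p
    have map_eq_mk (q : U) (hq : f ∉ q.1.asIdeal) :
        LocalizedModule.map q.1.asIdeal.primeCompl g (s.1 q) =
          LocalizedModule.mk (g m) ⟨f, hq⟩ := by
      rw [hm q hq, LocalizedModule.map_mk]
    exact ⟨U ⊓ PrimeSpectrum.basicOpen f, ⟨p.2, hpf⟩, Opens.infLELeft _ _, g m, f, fun q =>
      ⟨q.2.2, map_eq_mk ⟨q.1, q.2.1⟩ q.2.2⟩⟩⟩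
  map_add' s t := ext fun p =>
    map_add (LocalizedModule.map p.1.asIdeal.primeCompl g) (s.1 p) (t.1 p)
  map_smul' r s := ext fun p =>
    LinearMap.map_smul_of_tower (LocalizedModule.map p.1.asIdeal.primeCompl g) r (s.1 p)

lemma map_toOpenₗ (g : M →ₗ[R] N) (m : M) : map g (toOpenₗ R M U m) = toOpenₗ R N U (g m) :=
  ext fun p => LocalizedModule.map_mk p.1.asIdeal.primeCompl g m 1

lemma eq_of_smul_eq {I : Ideal R} (hU : ∀ p ∈ U, ¬ I ≤ p.asIdeal) {s t : ModuleSections M U}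
    (h : ∀ r ∈ I, r • s = r • t) : s = t := by
  refine ext fun p => ?_
  obtain ⟨r, hr, hrp⟩ := SetLike.not_le_iff_exists.1 (hU p.1 p.2)
  exact (localizedModule_smul_bijective (S := p.1.asIdeal.primeCompl) hrp).1
    (congrFun (congrArg Subtype.val (h r hr)) p)

lemma exists_pow_smul_eq_zero_of_toOpenₗ_eq_zero {f : R} (hf : PrimeSpectrum.basicOpen f ≤ U)
    {m : M} (hm : toOpenₗ R M U m = 0) : ∃ e : ℕ, f ^ e • m = 0 := by
  have restrict : toOpenₗ R M (PrimeSpectrum.basicOpen f) m = 0 :=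
    ext fun p => congrFun (congrArg Subtype.val hm) ⟨p.1, hf p.2⟩
  obtain ⟨⟨_, e, rfl⟩, he⟩ := (IsLocalizedModule.eq_zero_iff (Submonoid.powers f)
    (toOpenₗ R M (PrimeSpectrum.basicOpen f))).1 restrict
  exact ⟨e, he⟩

lemma exists_pow_smul_mk_eq_zero {f g : R} {m : M}
    (h : ∀ (p : PrimeSpectrum R) (hg : g ∉ p.asIdeal), f ∉ p.asIdeal →
      LocalizedModule.mk (S := p.asIdeal.primeCompl) m ⟨g, hg⟩ = 0) :
    ∃ e : ℕ, ∀ (p : PrimeSpectrum R) (hg : g ∉ p.asIdeal),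
      f ^ e • LocalizedModule.mk (S := p.asIdeal.primeCompl) m ⟨g, hg⟩ = 0 := by
  have toOpenₗ_eq_zero : toOpenₗ R M (PrimeSpectrum.basicOpen (f * g)) m = 0 := by
    refine ext fun p => ?_
    obtain ⟨hpf, hpg⟩ := (PrimeSpectrum.basicOpen_mul f g).le p.2
    have smul_mk_eq : g • LocalizedModule.mk (S := p.1.asIdeal.primeCompl) m ⟨g, hpg⟩ =
        LocalizedModule.mk m 1 := by
      rw [LocalizedModule.smul'_mk]
      exact LocalizedModule.mk_cancel ⟨g, hpg⟩ m
    exact smul_mk_eq.symm.trans ((congrArg (g • ·) (h p.1 hpg hpf)).trans (smul_zero g))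
  obtain ⟨e, he⟩ := exists_pow_smul_eq_zero_of_toOpenₗ_eq_zero le_rfl toOpenₗ_eq_zero
  refine ⟨e, fun p hg => (localizedModule_smul_bijective (S := p.asIdeal.primeCompl)
    (p.asIdeal.primeCompl.pow_mem hg e)).1 ?_⟩
  simp only [LocalizedModule.smul'_mk, ← mul_smul, ← mul_pow, mul_comm g f, he,
    LocalizedModule.zero_mk, smul_zero]

lemma exists_pow_smul_eq_zero (hU : IsCompact (U : Set (PrimeSpectrum R))) (f : R)
    (s : ModuleSections M U) (hs : ∀ p : U, f ∉ p.1.asIdeal → s.1 p = 0) :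
    ∃ e : ℕ, f ^ e • s = 0 := by
  choose g m hpg hgU hm using exists_fraction s
  have exists_pow (p : U) : ∃ e : ℕ, ∀ q : U, g p ∉ q.1.asIdeal → f ^ e • s.1 q = 0 := by
    obtain ⟨e, he⟩ := exists_pow_smul_mk_eq_zero (f := f) (g := g p) (m := m p)
      fun q hq hf => (hm p ⟨q, hgU p hq⟩ hq).symm.trans (hs _ hf)
    exact ⟨e, fun q hq => by rw [hm p q hq, he q.1 hq]⟩
  choose e he using exists_pow
  obtain ⟨t, ht⟩ := hU.elim_finite_subcover (fun p : U => PrimeSpectrum.basicOpen (g p))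
    (fun p => (PrimeSpectrum.basicOpen (g p)).2) fun p hp => Set.mem_iUnion.2 ⟨⟨p, hp⟩, hpg ⟨p, hp⟩⟩
  refine ⟨t.sup e, ext fun q => ?_⟩
  obtain ⟨p, hp, hq⟩ := Set.mem_iUnion₂.1 (ht q.2)
  change f ^ t.sup e • s.1 q = 0
  rw [← Nat.sub_add_cancel (Finset.le_sup hp : e p ≤ t.sup e), pow_add, mul_smul, he p q hq,
    smul_zero]

lemma exists_pow_smul_eq_toOpenₗ (hU : IsCompact (U : Set (PrimeSpectrum R))) {f : R}
    (hf : PrimeSpectrum.basicOpen f ≤ U) (s : ModuleSections M U) :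
    ∃ (e : ℕ) (m : M), f ^ e • s = toOpenₗ R M U m := by
  let restriction : ModuleSections M (PrimeSpectrum.basicOpen f) :=
    (structureSheafInType R M).1.map (homOfLE hf).op s
  obtain ⟨⟨m, ⟨_, e, rfl⟩⟩, hm⟩ := IsLocalizedModule.surj (Submonoid.powers f)
    (toOpenₗ R M (PrimeSpectrum.basicOpen f)) restriction
  have hm' : f ^ e • restriction = toOpenₗ R M (PrimeSpectrum.basicOpen f) m := hm
  obtain ⟨e', he'⟩ := exists_pow_smul_eq_zero hU f (f ^ e • s - toOpenₗ R M U m) fun p hp =>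
    sub_eq_zero.2 (congrFun (congrArg Subtype.val hm') ⟨p.1, hp⟩)
  refine ⟨e' + e, f ^ e' • m, ?_⟩
  rw [smul_sub, sub_eq_zero] at he'
  rw [pow_add, mul_smul, he', map_smul]

/-- The pairs `(r, m)` with `r • s = m`. -/
def fractionPairs (s : ModuleSections M U) : Submodule R (R × M) :=
  LinearMap.eqLocus ((LinearMap.toSpanSingleton R (ModuleSections M U) s).comp
    (LinearMap.fst R R M)) ((toOpenₗ R M U).comp (LinearMap.snd R R M))

lemma exists_fg_le_fractionPairs (hU : IsCompact (U : Set (PrimeSpectrum R))) {J : Ideal R}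
    (hJ : ∀ f ∈ J, PrimeSpectrum.basicOpen f ≤ U) (hJfg : J.FG) (s : ModuleSections M U) :
    ∃ T ≤ fractionPairs s, T.FG ∧ J ≤ Ideal.radical (T.map (LinearMap.fst R R M)) := by
  obtain ⟨S, rfl⟩ := hJfg
  choose! e m hm using fun f (hf : f ∈ S) =>
    exists_pow_smul_eq_toOpenₗ hU (hJ f (Submodule.subset_span hf)) s
  let pair (f : R) : R × M := (f ^ e f, m f)
  refine ⟨Submodule.span R (pair '' S), ?_, Submodule.fg_span (S.finite_toSet.image pair), ?_⟩
  · rw [Submodule.span_le, Set.image_subset_iff]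
    exact hm
  · exact Submodule.span_le.2 fun f hf => ⟨e f, ⟨pair f,
      Submodule.subset_span (Set.mem_image_of_mem _ hf), rfl⟩⟩

variable {J : Ideal R}

/-- Deligne's formula: the sections over the complement of `V(J)` are the elements of the direct
limit of the modules `Hom(Jᵃ, M)`. This is surjectivity; `exists_of_linearMap` is the map. -/
lemma exists_linearMap [IsNoetherianRing R] (hU : IsCompact (U : Set (PrimeSpectrum R)))
    (hJ : ∀ f ∈ J, PrimeSpectrum.basicOpen f ≤ U) (s : ModuleSections M U) :
    ∃ (a : ℕ) (φ : ↥(J ^ a) →ₗ[R] M), ∀ r : ↥(J ^ a), r.1 • s = toOpenₗ R M U (φ r) := by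
  obtain ⟨T, hT, hTfg, hJT⟩ := exists_fg_le_fractionPairs hU hJ (IsNoetherian.noetherian J) s
  let π : T →ₗ[R] R := (LinearMap.fst R R M).comp T.subtype
  have := Module.Finite.iff_fg.2 hTfg
  have ker_torsion : ∀ f ∈ J, ∀ q ∈ LinearMap.ker π, ∃ e : ℕ, f ^ e • q = 0 := by
    rintro f hf ⟨⟨r, m⟩, hq⟩ (rfl : r = 0)
    have hm : (0 : R) • s = toOpenₗ R M U m := hT hq
    obtain ⟨e, he⟩ := exists_pow_smul_eq_zero_of_toOpenₗ_eq_zero (hJ f hf)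
      (hm.symm.trans (zero_smul R s))
    exact ⟨e, Subtype.ext (Prod.ext (smul_zero _) he)⟩
  have range_eq : LinearMap.range π = T.map (LinearMap.fst R R M) := by
    rw [LinearMap.range_comp, Submodule.range_subtype]
  obtain ⟨a, φ, hφ⟩ := exists_linearMap_comp_eq J π ker_torsion (range_eq ▸ hJT)
  refine ⟨a, (LinearMap.snd R R M).comp (T.subtype.comp φ), fun r => ?_⟩
  have hr : (φ r).1.1 • s = toOpenₗ R M U (φ r).1.2 := hT (φ r).2
  exact hφ r ▸ hr

lemma mk_linearMap_eq (φ : ↥J →ₗ[R] M) {p : PrimeSpectrum R} {c d : J} (hc : c.1 ∉ p.asIdeal)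
    (hd : d.1 ∉ p.asIdeal) :
    LocalizedModule.mk (S := p.asIdeal.primeCompl) (φ c) ⟨c.1, hc⟩ =
      LocalizedModule.mk (φ d) ⟨d.1, hd⟩ := by
  refine LocalizedModule.mk_eq.2 ⟨1, ?_⟩
  simp only [Submonoid.smul_def, one_smul, ← map_smul]
  exact congrArg φ (Subtype.ext (mul_comm _ _))

lemma exists_of_linearMap (hU : ∀ p ∈ U, ¬ J ≤ p.asIdeal) (φ : ↥J →ₗ[R] M) :
    ∃ s : ModuleSections M U, ∀ r : J, r.1 • s = toOpenₗ R M U (φ r) := by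
  have exists_notMem (p : U) : ∃ r : J, r.1 ∉ p.1.asIdeal := by
    obtain ⟨r, hr, hrp⟩ := SetLike.not_le_iff_exists.1 (hU p.1 p.2)
    exact ⟨⟨r, hr⟩, hrp⟩
  choose r hr using exists_notMem
  refine ⟨⟨fun p => LocalizedModule.mk (φ (r p)) ⟨r p, hr p⟩, fun p => ?_⟩,
    fun c => ext fun p => ?_⟩
  · exact ⟨U ⊓ PrimeSpectrum.basicOpen (r p).1, ⟨p.2, hr p⟩, Opens.infLELeft _ _, φ (r p), r p,
      fun q => ⟨q.2.2, mk_linearMap_eq φ (hr ⟨q.1, q.2.1⟩) _⟩⟩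
  · refine (LocalizedModule.smul'_mk _ _ _).trans (LocalizedModule.mk_eq.2 ⟨1, ?_⟩)
    simp only [Submonoid.smul_def, one_smul, ← map_smul]
    exact congrArg φ (Subtype.ext (mul_comm _ _))

lemma exists_smul_eq {x : R} (hx : IsSMulRegular M x) (s : ModuleSections M U)
    (h : ∀ p : U, ∃ m : LocalizedModule p.1.asIdeal.primeCompl M, x • m = s.1 p) :
    ∃ t : ModuleSections M U, x • t = s := by
  choose t ht using h
  refine ⟨⟨t, fun p => ?_⟩, ext ht⟩
  obtain ⟨g, m, hpg, -, hm⟩ := exists_fraction s p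
  obtain ⟨m', ⟨d, hd⟩, htp⟩ : ∃ m' d, t p = LocalizedModule.mk m' d := by
    induction t p using LocalizedModule.induction_on with
    | h m s => exact ⟨m, s, rfl⟩
  have smul_mk_eq := ht p
  rw [htp, hm p hpg, LocalizedModule.smul'_mk] at smul_mk_eq
  obtain ⟨⟨c, hcp⟩, hc⟩ := LocalizedModule.mk_eq.1 smul_mk_eq
  refine ⟨U ⊓ (PrimeSpectrum.basicOpen c ⊓ (PrimeSpectrum.basicOpen d ⊓ PrimeSpectrum.basicOpen g)),
    ⟨p.2, hcp, hd, hpg⟩, Opens.infLELeft _ _, m', d, fun q => ⟨q.2.2.2.1, ?_⟩⟩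
  refine isSMulRegular_localizedModule hx ?_
  refine (ht ⟨q.1, q.2.1⟩).trans ((hm ⟨q.1, q.2.1⟩ q.2.2.2.2).trans (Eq.symm ?_))
  exact (LocalizedModule.smul'_mk _ _ _).trans (LocalizedModule.mk_eq.2 ⟨⟨c, q.2.2.1⟩, hc⟩)

end ModuleSections

end Sections

section LocalizedQuotient

variable {R M N : Type*} [CommRing R] [AddCommGroup M] [Module R M] [AddCommGroup N] [Module R N]
  {S : Submonoid R} {I : Ideal R}

lemma ker_localizedModule_map (g : M →ₗ[R] N) :
    LinearMap.ker (LocalizedModule.map S g) = (LinearMap.ker g).localized S :=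
  (LinearMap.localized'_ker_eq_ker_localizedMap ..).symm

lemma localized_pow_smul_top (n : ℕ) :
    (I ^ n • ⊤ : Submodule R M).localized S =
      I.map (algebraMap R (Localization S)) ^ n • ⊤ := by
  rw [Submodule.localized, Submodule.localized'_smul, Ideal.localized'_eq_map,
    Submodule.localized'_top, Ideal.map_pow]

lemma localizedModule_map_mkQ_eq_iff {n : ℕ} {μ ν : LocalizedModule S M} :
    LocalizedModule.map S (Submodule.mkQ (I ^ n • ⊤ : Submodule R M)) μ =
        LocalizedModule.map S (Submodule.mkQ _) ν ↔
      (Submodule.Quotient.mk μ : LocalizedModule S M ⧸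
          (I.map (algebraMap R (Localization S)) ^ n • ⊤ : Submodule (Localization S) _)) =
        Submodule.Quotient.mk ν := by
  rw [← LinearMap.sub_mem_ker_iff, ker_localizedModule_map, Submodule.ker_mkQ,
    localized_pow_smul_top, Submodule.Quotient.eq]

lemma localizedModule_map_powSMulProj (n k : ℕ) (μ : LocalizedModule S M) :
    LocalizedModule.map S (powSMulProj M I n k) (LocalizedModule.map S (Submodule.mkQ _) μ) =
      LocalizedModule.map S (Submodule.mkQ _) μ := by
  induction μ using LocalizedModule.induction_on with
  | h m f =>
    rw [LocalizedModule.map_mk, LocalizedModule.map_mk, LocalizedModule.map_mk]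
    rfl

lemma mem_map_span_singleton_pow_smul_top {x : R} {n : ℕ} {μ : LocalizedModule S M} :
    μ ∈ ((Ideal.span {x}).map (algebraMap R (Localization S)) ^ n • ⊤ :
      Submodule (Localization S) (LocalizedModule S M)) ↔ ∃ μ', x ^ n • μ' = μ := by
  rw [Ideal.map_span, Set.image_singleton, mem_span_singleton_pow_smul_top]
  simp only [← map_pow, algebraMap_smul]

lemma subsingleton_localizedModule_quotient (hS : ¬ Disjoint (S : Set R) I) (n : ℕ) :
    Subsingleton (LocalizedModule S (M ⧸ (I ^ n • ⊤ : Submodule R M))) := by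
  obtain ⟨f, hfS, hfI⟩ := Set.not_disjoint_iff.1 hS
  refine subsingleton_localizedModule (S.pow_mem hfS n) fun m => ?_
  obtain ⟨m, rfl⟩ := Submodule.mkQ_surjective _ m
  rw [← map_smul]
  exact (Submodule.Quotient.mk_eq_zero _).2
    (Submodule.smul_mem_smul (Ideal.pow_mem_pow hfI n) trivial)

end LocalizedQuotient

section AdicCompletion

variable {R M N : Type*} [CommRing R] [AddCommGroup M] [Module R M] [AddCommGroup N] [Module R N]
  {I J : Ideal R}

lemma adicCompletion_val_eq_mk_of_le {z : AdicCompletion I M} {m n : ℕ} (h : m ≤ n) {ν : M}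
    (hν : z.val n = Submodule.Quotient.mk ν) : z.val m = Submodule.Quotient.mk ν := by
  rw [← z.2 h, hν]
  rfl

section OfInjective

variable {f : M →ₗ[R] N} (hf : Function.Injective f) {k : ℕ}
  (hk : I ^ k • ⊤ ≤ LinearMap.range f)
include hf hk

lemma mem_pow_smul_top_of_apply_mem {n : ℕ} {m : M}
    (hm : f m ∈ (I ^ (n + k) • ⊤ : Submodule R N)) : m ∈ (I ^ n • ⊤ : Submodule R M) := by
  have map_le : (I ^ (n + k) • ⊤ : Submodule R N) ≤ (I ^ n • ⊤ : Submodule R M).map f := by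
    rw [Submodule.map_smul'', Submodule.map_top, pow_add, Submodule.mul_smul]
    exact Submodule.smul_mono le_rfl hk
  exact hf.mem_set_image.1 (map_le hm)

lemma isHausdorff_of_pow_smul_top_le_range [IsHausdorff I M] : IsHausdorff I N where
  haus' z hz := by
    obtain ⟨m, rfl⟩ := hk (SModEq.zero.1 (hz k))
    have hm : m = 0 := IsHausdorff.haus' (I := I) m fun n => SModEq.zero.2
      (mem_pow_smul_top_of_apply_mem hf hk (SModEq.zero.1 (hz (n + k))))
    rw [hm, map_zero]

lemma isPrecomplete_of_pow_smul_top_le_range [IsPrecomplete I M] : IsPrecomplete I N where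
  prec' c hc := by
    choose d hd using fun n => hk (SModEq.sub_mem.1 (hc (Nat.le_add_left k n)).symm)
    obtain ⟨l, hl⟩ := IsPrecomplete.prec' (I := I) d fun {m n} hmn => by
      rw [SModEq.sub_mem]
      refine mem_pow_smul_top_of_apply_mem hf hk ?_
      rw [map_sub, hd, hd, sub_sub_sub_cancel_right]
      exact SModEq.sub_mem.1 (hc (Nat.add_le_add_right hmn k))
    refine ⟨c k + f l, fun n => (hc (Nat.le_add_right n k)).trans ?_⟩
    rw [SModEq.sub_mem, ← sub_sub, ← hd, ← map_sub]
    exact Submodule.smul_top_le_comap_smul_top (I ^ n) f (SModEq.sub_mem.1 (hl n))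

lemma isAdicComplete_of_pow_smul_top_le_range [IsAdicComplete I M] : IsAdicComplete I N where
  toIsHausdorff := isHausdorff_of_pow_smul_top_le_range hf hk
  toIsPrecomplete := isPrecomplete_of_pow_smul_top_le_range hf hk

end OfInjective

lemma isAdicComplete_of_le (hJI : J ≤ I) [IsAdicComplete I M]
    (h : ∀ n, IsHausdorff I (M ⧸ (J ^ n • ⊤ : Submodule R M))) : IsAdicComplete J M where
  haus' z hz := IsHausdorff.haus' (I := I) z fun n =>
    (hz n).mono (Submodule.smul_mono_left (Ideal.pow_right_mono hJI n))
  prec' c hc := by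
    obtain ⟨l, hl⟩ := IsPrecomplete.prec' (I := I) c fun {m n} hmn =>
      (hc hmn).mono (Submodule.smul_mono_left (Ideal.pow_right_mono hJI m))
    refine ⟨l, fun n => ?_⟩
    rw [SModEq.sub_mem, ← Submodule.Quotient.mk_eq_zero]
    refine IsHausdorff.haus' (I := I) _ fun j => SModEq.zero.2 ?_
    have mk_eq : (Submodule.Quotient.mk (c n - l) : M ⧸ (J ^ n • ⊤ : Submodule R M)) =
        Submodule.mkQ _ (c (n + j) - l) := by
      refine (Submodule.Quotient.eq _).2 ?_
      rw [sub_sub_sub_cancel_right]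
      exact SModEq.sub_mem.1 (hc (Nat.le_add_right n j))
    rw [mk_eq]
    exact Submodule.smul_top_le_comap_smul_top (I ^ j) _
      (Submodule.smul_mono_left (Ideal.pow_le_pow_right (Nat.le_add_left j n))
        (SModEq.sub_mem.1 (hl (n + j))))

lemma isAdicComplete_of_le_of_isNoetherianRing [IsNoetherianRing R] (hJI : J ≤ I)
    [IsAdicComplete I R] : IsAdicComplete J R :=
  isAdicComplete_of_le hJI fun _ => .of_le_jacobson _ _ (IsAdicComplete.le_jacobson_bot I)

end AdicCompletion

lemma exists_pow_smul_eq_zero_of_isFiniteLength {R H : Type*} [CommRing R] [AddCommGroup H]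
    [Module R H] {x : R} (hx : x ∈ Ring.jacobson R) (h : IsFiniteLength R H) :
    ∃ k : ℕ, ∀ z : H, x ^ k • z = 0 := by
  induction h with
  | of_subsingleton => exact ⟨0, fun z => Subsingleton.elim _ _⟩
  | @of_simple_quotient H _ _ N _ _ ih =>
    obtain ⟨k, hk⟩ := ih
    have : (Module.annihilator R (H ⧸ N)).IsMaximal := IsSimpleModule.annihilator_isMaximal
    have mem_annihilator := Module.mem_annihilator.1
      (Ring.jacobson_le_of_isMaximal (Module.annihilator R (H ⧸ N)) hx)
    refine ⟨k + 1, fun z => ?_⟩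
    rw [pow_succ, mul_smul]
    exact congrArg Subtype.val
      (hk ⟨x • z, (Submodule.Quotient.mk_eq_zero N).1 (mem_annihilator (Submodule.Quotient.mk z))⟩)

section SectionsLocalCohomology

open StructureSheaf

variable {R : Type u} [CommRing R] [IsNoetherianRing R] {M : Type u} [AddCommGroup M] [Module R M]
  {J : Ideal R} {U : Opens (PrimeSpectrum R)} (hU : ∀ p, p ∈ U ↔ ¬ J ≤ p.asIdeal)

namespace ModuleSections

include hU

lemma exists_linearMap_of_mem_iff (s : ModuleSections M U) :
    ∃ (a : ℕ) (φ : ↥(J ^ a) →ₗ[R] M), ∀ r : ↥(J ^ a), r.1 • s = toOpenₗ R M U (φ r) :=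
  exists_linearMap (NoetherianSpace.isCompact _)
    (fun _ hf p hp => (hU p).2 fun hJp => hp (hJp hf)) s

lemma exists_smul_eq_toOpenₗ {r : R}
    (h : ∀ z : (localCohomology J 1).obj (ModuleCat.of R M), r • z = 0) (s : ModuleSections M U) :
    ∃ m : M, r • s = toOpenₗ R M U m := by
  obtain ⟨a, φ, hφ⟩ := exists_linearMap_of_mem_iff hU s
  obtain ⟨b, hb, m, hm⟩ := exists_smul_linearMap_eq_smul J r h a φ
  refine ⟨m, eq_of_smul_eq (I := J ^ b) (fun p hp hle => (hU p).1 hp (p.2.le_of_pow_le hle))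
    fun t ht => ?_⟩
  rw [smul_comm, hφ ⟨t, hb ht⟩, ← map_smul, hm t ht, map_smul]

lemma exists_map_mkQ_eq_map_powSMulProj {x : R} (hx : IsSMulRegular M x) {k : ℕ}
    (h : ∀ z : (localCohomology J 2).obj (ModuleCat.of R M), x ^ k • z = 0) (n : ℕ)
    (s : ModuleSections (M ⧸ (Ideal.span {x} ^ (n + k) • ⊤ : Submodule R M)) U) :
    ∃ t : ModuleSections M U, map (Submodule.mkQ _) t = map (powSMulProj M _ n k) s := by
  obtain ⟨a, φ, hφ⟩ := exists_linearMap_of_mem_iff hU s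
  obtain ⟨b, hb, ψ, hψ⟩ := exists_lift_powSMulProj_comp J hx k h n a φ
  have not_pow_le : ∀ p ∈ U, ¬ J ^ b ≤ p.asIdeal := fun p hp hle =>
    (hU p).1 hp (p.2.le_of_pow_le hle)
  obtain ⟨t, ht⟩ := exists_of_linearMap not_pow_le ψ
  refine ⟨t, eq_of_smul_eq not_pow_le fun r hr => ?_⟩
  rw [← map_smul, ht ⟨r, hr⟩, map_toOpenₗ, hψ r hr, ← map_smul, hφ ⟨r, hb hr⟩, map_toOpenₗ]

lemma isAdicComplete {I : Ideal R} {k : ℕ} [IsAdicComplete I M]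
    (hM : Function.Injective (toOpenₗ R M U))
    (h : ∀ r ∈ I ^ k, ∀ z : (localCohomology J 1).obj (ModuleCat.of R M), r • z = 0) :
    IsAdicComplete I (ModuleSections M U) := by
  refine isAdicComplete_of_pow_smul_top_le_range (k := k) hM
    (Submodule.smul_le.2 fun r hr s _ => ?_)
  obtain ⟨m, hm⟩ := exists_smul_eq_toOpenₗ hU (h r hr) s
  exact ⟨m, hm.symm⟩

end ModuleSections

end SectionsLocalCohomology

section Comparison

open StructureSheaf

variable {R : Type u} [CommRing R] [IsLocalRing R] {M : Type u} [AddCommGroup M] [Module R M]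
  {a : Ideal R} {x : R}

/-- The punctured spectrum as an open subset of the prime spectrum. -/
abbrev puncturedOpens (R : Type u) [CommRing R] [IsLocalRing R] : Opens (PrimeSpectrum R) :=
  puncturedSpectrum R

lemma mem_puncturedOpens_iff (p : PrimeSpectrum R) :
    p ∈ puncturedOpens R ↔ ¬ maximalIdeal R ≤ p.asIdeal := by
  refine not_congr ⟨fun h => (congrArg PrimeSpectrum.asIdeal h).ge, fun h => ?_⟩
  exact PrimeSpectrum.ext ((maximalIdeal.isMaximal R).eq_of_le p.2.ne_top h).symm

namespace ModuleSections

/-- The germ at a point of `Y` of a section over the punctured spectrum. -/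
noncomputable def germ (y : puncturedLocusTop a) : ModuleSections M (puncturedOpens R) →ₗ[R]
    LocalizedModule (toSpec y).asIdeal.primeCompl M where
  toFun s := s.1 ⟨toSpec y, y.2.2⟩
  map_add' _ _ := rfl
  map_smul' _ _ := rfl

lemma germ_map {N : Type u} [AddCommGroup N] [Module R N] (g : M →ₗ[R] N)
    (s : ModuleSections M (puncturedOpens R)) (y : puncturedLocusTop a) :
    germ y (map g s) = LocalizedModule.map _ g (germ y s) :=
  rfl

lemma exists_germ_eq
    (hM : ∀ p ∉ PrimeSpectrum.zeroLocus (a : Set R),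
      Subsingleton (LocalizedModule p.asIdeal.primeCompl M))
    (q : ∀ y : puncturedLocusTop a, LocalizedModule (toSpec y).asIdeal.primeCompl M)
    (hq : ∀ y, ∃ V : Opens (puncturedLocusTop a), y ∈ V ∧ ∃ (m : M) (f : R), ∀ z ∈ V,
      ∃ hf : f ∉ (toSpec z).asIdeal, q z = LocalizedModule.mk m ⟨f, hf⟩) :
    ∃ s : ModuleSections M (puncturedOpens R), ∀ y, germ y s = q y := by
  classical
  let s (p : puncturedOpens R) : LocalizedModule p.1.asIdeal.primeCompl M :=
    if h : p.1 ∈ puncturedLocus a then q ⟨p.1, h⟩ else 0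
  have s_eq (y : puncturedLocusTop a) : s ⟨toSpec y, y.2.2⟩ = q y := dif_pos y.2
  refine ⟨⟨s, fun p => ?_⟩, s_eq⟩
  by_cases hp : p.1 ∈ PrimeSpectrum.zeroLocus (a : Set R)
  · obtain ⟨V, hpV, m, f, hV⟩ := hq ⟨p.1, hp, p.2⟩
    obtain ⟨W, hW, hWV⟩ := isOpen_induced_iff.1 V.2
    have mem_V_iff (z : puncturedLocusTop a) : toSpec z ∈ W ↔ z ∈ V := Set.ext_iff.1 hWV z
    obtain ⟨hfp, -⟩ := hV _ hpV
    refine ⟨puncturedOpens R ⊓ (⟨W, hW⟩ ⊓ PrimeSpectrum.basicOpen f),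
      ⟨p.2, (mem_V_iff _).2 hpV, hfp⟩, Opens.infLELeft _ _, m, f, fun z => ⟨z.2.2.2, ?_⟩⟩
    by_cases hz : z.1 ∈ PrimeSpectrum.zeroLocus (a : Set R)
    · obtain ⟨_, hq⟩ := hV ⟨z.1, hz, z.2.1⟩ ((mem_V_iff _).1 z.2.2.1)
      exact (s_eq ⟨z.1, hz, z.2.1⟩).trans hq
    · have := hM z.1 hz
      exact Subsingleton.elim _ _
  · refine ⟨puncturedOpens R ⊓ ⟨(PrimeSpectrum.zeroLocus (a : Set R))ᶜ,
      (PrimeSpectrum.isClosed_zeroLocus _).isOpen_compl⟩, ⟨p.2, hp⟩, Opens.infLELeft _ _, 0, 1,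
      fun z => ⟨(Ideal.ne_top_iff_one _).1 (PrimeSpectrum.isPrime z.1).ne_top, ?_⟩⟩
    have := hM z.1 z.2.2
    exact Subsingleton.elim _ _

lemma exists_germ_eq_map_mkQ (σ : completionSections a M ⊤) (n : ℕ) :
    ∃ s : ModuleSections (M ⧸ (a ^ n • ⊤ : Submodule R M)) (puncturedOpens R),
      ∀ y, ∃ μ : LocalizedModule (toSpec y).asIdeal.primeCompl M,
        (σ.1 ⟨y, trivial⟩).val n = Submodule.Quotient.mk μ ∧
          germ y s = LocalizedModule.map _ (Submodule.mkQ _) μ := by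
  choose lift hlift using fun y : puncturedLocusTop a =>
    Submodule.Quotient.mk_surjective _ ((σ.1 ⟨y, trivial⟩).val n)
  have map_lift_eq (y) (μ : LocalizedModule (toSpec y).asIdeal.primeCompl M)
      (hμ : (σ.1 ⟨y, trivial⟩).val n = Submodule.Quotient.mk μ) :
      LocalizedModule.map _ (Submodule.mkQ (a ^ n • ⊤)) (lift y) =
        LocalizedModule.map _ (Submodule.mkQ _) μ :=
    localizedModule_map_mkQ_eq_iff.2 ((hlift y).trans hμ)
  obtain ⟨s, hs⟩ := exists_germ_eq (a := a) (M := M ⧸ (a ^ n • ⊤ : Submodule R M))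
    (fun p hp => subsingleton_localizedModule_quotient (fun hdisj => hp fun f hf =>
      of_not_not fun hfp => Set.disjoint_left.1 hdisj hfp hf) n)
    (fun y => LocalizedModule.map _ (Submodule.mkQ _) (lift y)) fun y => by
      obtain ⟨V, hyV, _, m, f, hV⟩ := σ.2 n ⟨y, trivial⟩
      refine ⟨V, hyV, Submodule.mkQ _ m, f, fun z hz => ?_⟩
      obtain ⟨hf, hσ⟩ := hV ⟨z, hz⟩
      exact ⟨hf, (map_lift_eq z _ hσ).trans (LocalizedModule.map_mk _ _ _ _)⟩
  exact ⟨s, fun y => ⟨lift y, (hlift y).symm, hs y⟩⟩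

lemma exists_val_eq_mk_germ [IsNoetherianRing R] (hx : IsSMulRegular M x) {k : ℕ}
    (h : ∀ z : (localCohomology (maximalIdeal R) 2).obj (ModuleCat.of R M), x ^ k • z = 0)
    (σ : completionSections (Ideal.span {x}) M ⊤) (n : ℕ) :
    ∃ t : ModuleSections M (puncturedOpens R), ∀ y,
      (σ.1 ⟨y, trivial⟩).val n = Submodule.Quotient.mk (germ y t) := by
  obtain ⟨s, hs⟩ := exists_germ_eq_map_mkQ σ (n + k)
  obtain ⟨t, ht⟩ := exists_map_mkQ_eq_map_powSMulProj mem_puncturedOpens_iff hx h n s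
  choose μ hμ germ_s_eq using hs
  refine ⟨t, fun y => ?_⟩
  have germ_eq : LocalizedModule.map _ (Submodule.mkQ (Ideal.span {x} ^ n • ⊤)) (μ y) =
      LocalizedModule.map _ (Submodule.mkQ _) (germ y t) := by
    rw [← germ_map, ht, germ_map, germ_s_eq, localizedModule_map_powSMulProj]
  exact (adicCompletion_val_eq_mk_of_le (Nat.le_add_right n k) (hμ y)).trans
    (localizedModule_map_mkQ_eq_iff.1 germ_eq)

lemma sModEq_iff_germ (hx : IsSMulRegular M x) {n : ℕ}
    {s t : ModuleSections M (puncturedOpens R)} :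
    s ≡ t [SMOD (Ideal.span {x} ^ n • ⊤ : Submodule R (ModuleSections M (puncturedOpens R)))] ↔
      ∀ y : puncturedLocusTop (Ideal.span {x}), germ y s ≡ germ y t
        [SMOD ((Ideal.span {x}).map
          (algebraMap R (Localization (toSpec y).asIdeal.primeCompl)) ^ n • ⊤ :
            Submodule (Localization (toSpec y).asIdeal.primeCompl) _)] := by
  simp only [SModEq.sub_mem, mem_map_span_singleton_pow_smul_top, mem_span_singleton_pow_smul_top,
    ← map_sub]
  constructor
  · rintro ⟨u, hu⟩ y
    exact ⟨germ y u, by rw [← map_smul, hu]⟩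
  · intro h
    refine exists_smul_eq (hx.pow n) _ fun p => ?_
    by_cases hp : x ∈ p.1.asIdeal
    · exact h ⟨p.1, (Ideal.span_singleton_le_iff_mem _).2 hp, p.2⟩
    · exact (localizedModule_smul_bijective (p.1.asIdeal.primeCompl.pow_mem hp n)).2 _

end ModuleSections

open ModuleSections

lemma toOpenₗ_puncturedOpens_injective (hx : IsSMulRegular M x) [IsHausdorff (Ideal.span {x}) M] :
    Function.Injective (toOpenₗ R M (puncturedOpens R)) := by
  refine (injective_iff_map_eq_zero _).2 fun m hm => ?_
  by_cases hxm : x ∈ maximalIdeal R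
  · obtain ⟨e, he⟩ := exists_pow_smul_eq_zero_of_toOpenₗ_eq_zero
      (fun p hp => (mem_puncturedOpens_iff p).2 fun hle => hp (hle hxm)) hm
    exact (hx.pow e) (he.trans (smul_zero _).symm)
  · refine IsHausdorff.haus' (I := Ideal.span {x}) m fun n => ?_
    rw [Ideal.span_singleton_eq_top.2 (of_not_not hxm), Ideal.top_pow, Submodule.top_smul]
    exact SModEq.top

lemma isAdicComplete_moduleSections [IsNoetherianRing R] (hx : IsSMulRegular M x)
    [IsAdicComplete (Ideal.span {x}) M] {k : ℕ}
    (h : ∀ z : (localCohomology (maximalIdeal R) 1).obj (ModuleCat.of R M), x ^ k • z = 0) :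
    IsAdicComplete (Ideal.span {x}) (ModuleSections M (puncturedOpens R)) := by
  refine isAdicComplete mem_puncturedOpens_iff (k := k) (toOpenₗ_puncturedOpens_injective hx)
    fun r hr z => ?_
  rw [Ideal.span_singleton_pow] at hr
  obtain ⟨c, rfl⟩ := Ideal.mem_span_singleton'.1 hr
  rw [mul_smul, h, smul_zero]

lemma toCompletion_injective (hx : IsSMulRegular M x)
    [IsHausdorff (Ideal.span {x}) (ModuleSections M (puncturedOpens R))] :
    Function.Injective (toCompletion (Ideal.span {x}) M) := by
  refine (injective_iff_map_eq_zero _).2 fun s hs => ?_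
  refine IsHausdorff.haus' (I := Ideal.span {x}) (M := ModuleSections M (puncturedOpens R)) s
    fun n => (sModEq_iff_germ hx).2 fun y => ?_
  exact congrArg (fun c => c.val n) (congrFun (congrArg Subtype.val hs) ⟨y, trivial⟩)

lemma toCompletion_surjective (hx : IsSMulRegular M x)
    [IsPrecomplete (Ideal.span {x}) (ModuleSections M (puncturedOpens R))]
    (h : ∀ (σ : completionSections (Ideal.span {x}) M ⊤) (n : ℕ),
      ∃ t : ModuleSections M (puncturedOpens R), ∀ y,
        (σ.1 ⟨y, trivial⟩).val n = Submodule.Quotient.mk (germ y t)) :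
    Function.Surjective (toCompletion (Ideal.span {x}) M) := by
  intro σ
  choose t ht using h σ
  obtain ⟨s, hs⟩ := IsPrecomplete.prec' (I := Ideal.span {x}) t fun {m n} hmn =>
    (sModEq_iff_germ hx).2 fun y =>
      (ht m y).symm.trans (adicCompletion_val_eq_mk_of_le hmn (ht n y))
  refine ⟨s, Subtype.ext (funext fun y => AdicCompletion.ext fun n => ?_)⟩
  exact ((ht n y.1).trans ((sModEq_iff_germ hx).1 (hs n) y.1)).symm

lemma toCompletion_bijective [IsNoetherianRing R] (hx : IsSMulRegular M x)
    [IsAdicComplete (Ideal.span {x}) M] {k l : ℕ}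
    (h₁ : ∀ z : (localCohomology (maximalIdeal R) 1).obj (ModuleCat.of R M), x ^ k • z = 0)
    (h₂ : ∀ z : (localCohomology (maximalIdeal R) 2).obj (ModuleCat.of R M), x ^ l • z = 0) :
    Function.Bijective (toCompletion (Ideal.span {x}) M) := by
  have := isAdicComplete_moduleSections hx h₁
  exact ⟨toCompletion_injective hx, toCompletion_surjective hx (exists_val_eq_mk_germ hx h₂)⟩

lemma isG2_iff : IsG2 a ↔ Function.Bijective (toCompletion a R) := Iff.rfl

end Comparison

end FormalGeometry

theorem mainTheorem11_general {R : Type u} [CommRing R] [IsLocalRing R] [IsNoetherianRing R]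
    (x : R) :
    (∀ (M : Type u) [AddCommGroup M] [Module R M],
      IsSMulRegular M x →
      IsAdicComplete (Ideal.span {x}) M →
      (∃ k : ℕ, ∀ z : (localCohomology (maximalIdeal R) 1).obj (ModuleCat.of R M),
        x ^ k • z = 0) →
      (∃ k : ℕ, ∀ z : (localCohomology (maximalIdeal R) 2).obj (ModuleCat.of R M),
        x ^ k • z = 0) →
      Function.Bijective (FormalGeometry.toCompletion (Ideal.span {x}) M)) ∧
    (IsAdicComplete (maximalIdeal R) R →
      IsFiniteLength R ((localCohomology (maximalIdeal R) 1).obj (ModuleCat.of R R)) →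
      IsFiniteLength R ((localCohomology (maximalIdeal R) 2).obj (ModuleCat.of R R)) →
      x ∈ maximalIdeal R →
      IsSMulRegular R x →
      FormalGeometry.IsG2 (Ideal.span {x})) := by
  refine ⟨fun M _ _ hx _ ⟨_, h₁⟩ ⟨_, h₂⟩ => FormalGeometry.toCompletion_bijective hx h₁ h₂,
    fun _ hH₁ hH₂ hxm hx => ?_⟩
  have : IsAdicComplete (Ideal.span {x}) R :=
    FormalGeometry.isAdicComplete_of_le_of_isNoetherianRing
      ((Ideal.span_singleton_le_iff_mem _).2 hxm)
  have hxj : x ∈ Ring.jacobson R := by rwa [IsLocalRing.ringJacobson_eq_maximalIdeal]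
  obtain ⟨k, h₁⟩ := FormalGeometry.exists_pow_smul_eq_zero_of_isFiniteLength hxj hH₁
  obtain ⟨l, h₂⟩ := FormalGeometry.exists_pow_smul_eq_zero_of_isFiniteLength hxj hH₂
  exact FormalGeometry.isG2_iff.2 (FormalGeometry.toCompletion_bijective hx h₁ h₂)

theorem mainTheorem11 {R : Type u} [CommRing R] [IsLocalRing R] [IsNoetherianRing R] (x : R) :
    (∀ (M : Type u) [AddCommGroup M] [Module R M] [Module.Finite R M],
      IsSMulRegular M x →
      IsAdicComplete (Ideal.span {x}) M →
      (∃ k : ℕ, ∀ z : (localCohomology (maximalIdeal R) 1).obj (ModuleCat.of R M),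
        x ^ k • z = 0) →
      (∃ k : ℕ, ∀ z : (localCohomology (maximalIdeal R) 2).obj (ModuleCat.of R M),
        x ^ k • z = 0) →
      Function.Bijective (FormalGeometry.toCompletion (Ideal.span {x}) M)) ∧
    (IsAdicComplete (maximalIdeal R) R →
      FormalGeometry.IsGeneralizedCohenMacaulay R →
      2 < ringKrullDim R →
      x ∈ maximalIdeal R →
      IsSMulRegular R x →
      FormalGeometry.IsG2 (Ideal.span {x})) :=
  ⟨fun M _ _ _ => (mainTheorem11_general x).1 M, fun hc hR hdim =>
    (mainTheorem11_general x).2 hc (hR 1 (lt_trans (by norm_num) hdim)) (hR 2 hdim)⟩
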